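/- Let $\alpha,\beta>-1$ and write $\beta=\beta_0+m$ with $m\in\mathbb N=\{0,1,2,\dots\}$ and $-1<\beta_0\le 0$. Let $\mathbb D$ be the open unit disk in $\mathbb C$, $\mathbb D^*=\mathbb D\setminus\{0\}$, $dA=\pi^{-1}dx\,dy$, let $\mathscr B$ be the beta function, and put $$d\mu_{\alpha,\beta}(z)=\frac{1}{\mathscr B(\alpha+1,\beta+1)}|z|^{2\beta}(1-|z|^2)^{\alpha}\,dA(z).$$ For $1\le p<\infty$ let $\mathcal A^p_{\alpha,\beta}$ be the space of holomorphic functions $f$ on $\mathbb D^*$ with $\|f\|_{\alpha,\beta,p}=\big(\int_{\mathbb D}|f|^p\,d\mu_{\alpha,\beta}\big)^{1/p}<\infty$, normed by $\|\cdot\|_{\alpha,\beta,p}$. For $w,z\in\mathbb D^*$ set, with $\xi=w\overline z$, $$\mathbb K_{\alpha,\beta}(w,z)=\frac{\mathscr B(\alpha+1,\beta+1)}{\mathscr B(\alpha+1,\beta_0+1)}\,\xi^{-m}\,{}_2F_1(1,\alpha+\beta_0+2;\beta_0+1;\xi).$$ Suppose that $$\frac{2(\beta+1)}{2(\beta+1)-m}<p\qquad\text{and}\qquad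 mp<2(\beta+1)$$ (for $m=0$ this means $1<p<\infty$). Then $\mathbb K_{\alpha,\beta}$ is a reproducing kernel of $\mathcal A^2_{\alpha,\beta}$, that is, for every $z\in\mathbb D^*$ one has $\mathbb K_{\alpha,\beta}(\cdot,z)\in\mathcal A^2_{\alpha,\beta}$ and $f(z)=\int_{\mathbb D}f(w)\overline{\mathbb K_{\alpha,\beta}(w,z)}\,d\mu_{\alpha,\beta}(w)$ for all $f\in\mathcal A^2_{\alpha,\beta}$. Moreover $\mathbb K_{\alpha,\beta}(\cdot,z)\in\mathcal A^p_{\alpha,\beta}$ for every $z\in\mathbb D^*$, and the normalized reproducing kernels $$k^z_{\alpha,\beta,p}(w)=\frac{\mathbb K_{\alpha,\beta}(w,z)}{\|\mathbb K_{\alpha,\beta}(\cdot,z)\|_{\alpha,\beta,p}}$$ converge to $0$ weakly in $\mathcal A^p_{\alpha,\beta}$ as $|z|\to1^-$. -/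

import Mathlib

open MeasureTheory Filter Topology

noncomputable section

namespace ModifiedBergman

/-- The punctured unit disk `𝔻* = {z : 0 < |z| < 1}`. -/
def puncturedDisk : Set ℂ := {z | 0 < ‖z‖ ∧ ‖z‖ < 1}

/-- The probability measure
`dμ_{α,β}(z) = B(α+1,β+1)⁻¹ |z|^{2β} (1-|z|²)^α dA(z)` on the unit disk (extended by zero to `ℂ`),
where `dA = π⁻¹ dx dy` is the normalized area measure. -/
def bergmanMeasure (α β : ℝ) : Measure ℂ :=
  (volume.restrict (Metric.ball (0 : ℂ) 1)).withDensity fun z =>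
    ENNReal.ofReal ((ProbabilityTheory.beta (α + 1) (β + 1))⁻¹ *
      (‖z‖ ^ (2 * β) * (1 - ‖z‖ ^ 2) ^ α) * Real.pi⁻¹)

/-- `f` belongs to the `β`-modified Bergman space: `f` is holomorphic on `𝔻*` and `|f|^p` is
`μ_{α,β}`-integrable. The values of `f` outside `𝔻*` play no role. -/
def MemBergman (α β p : ℝ) (f : ℂ → ℂ) : Prop :=
  DifferentiableOn ℂ f puncturedDisk ∧ MemLp f (ENNReal.ofReal p) (bergmanMeasure α β)

/-- The norm `‖f‖_{α,β,p} = (∫ |f|^p dμ_{α,β})^{1/p}`. -/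
def bergmanNorm (α β p : ℝ) (f : ℂ → ℂ) : ℝ :=
  (∫ z, ‖f z‖ ^ p ∂(bergmanMeasure α β)) ^ (1 / p)

/-- The `β`-modified Bergman space `𝒜^p_{α,β}`, as the subspace of `L^p(μ_{α,β})` of the classes that
have a representative holomorphic on `𝔻*`; it carries the `L^p` norm. -/
def bergmanSpace (α β p : ℝ) : Submodule ℂ (Lp ℂ (ENNReal.ofReal p) (bergmanMeasure α β)) where
  carrier := {F | ∃ f, MemBergman α β p f ∧ F =ᵐ[bergmanMeasure α β] f}
  zero_mem' := ⟨0, ⟨differentiableOn_const 0, MemLp.zero⟩, Lp.coeFn_zero _ _ _⟩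
  add_mem' := by
    rintro F G ⟨f, hf, hF⟩ ⟨g, hg, hG⟩
    exact ⟨f + g, ⟨hf.1.add hg.1, hf.2.add hg.2⟩, (Lp.coeFn_add F G).trans (hF.add hG)⟩
  smul_mem' := by
    rintro c F ⟨f, hf, hF⟩
    exact ⟨c • f, ⟨hf.1.const_smul c, hf.2.const_smul c⟩,
      (Lp.coeFn_smul c F).trans (hF.const_smul c)⟩

/-- The element of `𝒜^p_{α,β}` given by a function. -/
def MemBergman.toBergman {α β p : ℝ} {f : ℂ → ℂ} (hf : MemBergman α β p f) :
    bergmanSpace α β p :=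
  ⟨hf.2.toLp f, f, hf, hf.2.coeFn_toLp⟩

/-- The non-negative integer `m` with `β = β₀ + m` and `-1 < β₀ ≤ 0` (for `β > -1`). -/
def poleOrder (β : ℝ) : ℕ := ⌈β⌉₊

theorem poleOrder_spec {β : ℝ} (hβ : -1 < β) :
    -1 < β - poleOrder β ∧ β - poleOrder β ≤ 0 := by
  constructor
  · rcases le_or_gt β 0 with h | h
    · simp [poleOrder, Nat.ceil_eq_zero.2 h, hβ]
    · have := Nat.ceil_lt_add_one h.le
      unfold poleOrder
      linarith
  · have := Nat.le_ceil β
    unfold poleOrder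
    linarith

/-- The kernel `K_{α,β}(w,z) = B(α+1,β+1) / B(α+1,β₀+1) · ξ^{-m} · ₂F₁(1, α+β₀+2; β₀+1; ξ)`, where
`ξ = w z̄` and `β = β₀ + m` with `-1 < β₀ ≤ 0`. -/
def bergmanKernel (α β : ℝ) (w z : ℂ) : ℂ :=
  let m : ℕ := poleOrder β
  let β₀ : ℝ := β - m
  let ξ : ℂ := w * (starRingEnd ℂ) z
  ((ProbabilityTheory.beta (α + 1) (β + 1) / ProbabilityTheory.beta (α + 1) (β₀ + 1) : ℝ) : ℂ) *
    (ξ ^ m)⁻¹ * ordinaryHypergeometric (1 : ℂ) ((α + β₀ + 2 : ℝ) : ℂ) ((β₀ + 1 : ℝ) : ℂ) ξ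

/-- `K` is a reproducing kernel of the Hilbert space `𝒜²_{α,β}`: every `K(·,z)` belongs to it, and
`f(z) = ⟨f, K(·,z)⟩_{α,β}` for every `f` in it. -/
def IsReproducingKernel (α β : ℝ) (K : ℂ → ℂ → ℂ) : Prop :=
  ∀ z ∈ puncturedDisk, MemBergman α β 2 (fun w => K w z) ∧
    ∀ f, MemBergman α β 2 f →
      ∫ w, f w * (starRingEnd ℂ) (K w z) ∂(bergmanMeasure α β) = f z

/-- The normalized reproducing kernel `k^z_{α,β,p}(w) = K_{α,β}(w,z) / ‖K_{α,β}(·,z)‖_{α,β,p}`. -/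
def normalizedKernel (α β p : ℝ) (z w : ℂ) : ℂ :=
  bergmanKernel α β w z / (bergmanNorm α β p (fun w => bergmanKernel α β w z) : ℂ)

theorem memBergman_normalizedKernel {α β p : ℝ} {z : ℂ}
    (h : MemBergman α β p (fun w => bergmanKernel α β w z)) :
    MemBergman α β p (normalizedKernel α β p z) := by
  have e : normalizedKernel α β p z =
      (bergmanNorm α β p (fun w => bergmanKernel α β w z) : ℂ)⁻¹ •
        (fun w => bergmanKernel α β w z) := by
    funext w
    simp [normalizedKernel, div_eq_inv_mul]
  rw [e]
  exact ⟨h.1.const_smul _, h.2.const_smul _⟩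

/-- The filter `|z| → 1⁻` on `𝔻*`. -/
def towardsBoundary : Filter puncturedDisk :=
  comap (fun z : puncturedDisk => ‖(z : ℂ)‖) (𝓝[<] 1)

end ModifiedBergman

end

namespace ModifiedBergman
open scoped ENNReal

/-- The radial density of `μ_{α,β}` with respect to Lebesgue measure on the unit disk. -/
noncomputable def bergmanDensity (α β r : ℝ) : ℝ :=
  (ProbabilityTheory.beta (α + 1) (β + 1))⁻¹ * (r ^ (2 * β) * (1 - r ^ 2) ^ α) * Real.pi⁻¹

theorem bergmanMeasure_eq (α β : ℝ) :
    bergmanMeasure α β = (volume.restrict (Metric.ball (0 : ℂ) 1)).withDensity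
      fun z => ENNReal.ofReal (bergmanDensity α β ‖z‖) := rfl

theorem measurable_bergmanDensity (α β : ℝ) : Measurable (bergmanDensity α β) := by
  unfold bergmanDensity
  fun_prop

theorem bergmanDensity_pos {α β r : ℝ} (hα : -1 < α) (hβ : -1 < β) (h0 : 0 < r) (h1 : r < 1) :
    0 < bergmanDensity α β r := by
  have := ProbabilityTheory.beta_pos (show 0 < α + 1 by linarith) (show 0 < β + 1 by linarith)
  have h2 : 0 < 1 - r ^ 2 := by nlinarith
  unfold bergmanDensity
  positivity

theorem lintegral_ball_norm {D : ℝ → ℝ≥0∞} (hD : Measurable D) :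
    ∫⁻ z in Metric.ball (0 : ℂ) 1, D ‖z‖ =
      ENNReal.ofReal (2 * Real.pi) * ∫⁻ r in Set.Ioo (0 : ℝ) 1, ENNReal.ofReal r * D r := by
  rw [← lintegral_indicator Metric.isOpen_ball.measurableSet,
    ← Complex.lintegral_comp_polarCoord_symm, polarCoord_target, Measure.volume_eq_prod,
    ← Measure.prod_restrict, ← lintegral_indicator measurableSet_Ioo]
  have e : ∀ p : ℝ × ℝ, ENNReal.ofReal p.1 • (Metric.ball (0 : ℂ) 1).indicator (fun z => D ‖z‖)
      (Complex.polarCoord.symm p) =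
      (fun r : ℝ => ENNReal.ofReal r • (Set.Iio 1).indicator D |r|) p.1 * (fun _ => 1) p.2 := by
    intro p
    simp only [Set.indicator, Metric.mem_ball, dist_zero_right, Complex.norm_polarCoord_symm,
      Set.mem_Iio, mul_one]
  rw [lintegral_congr e, lintegral_prod_mul
    (f := fun r : ℝ => ENNReal.ofReal r • (Set.Iio 1).indicator D |r|) (g := fun _ => 1)]
  · rw [mul_comm]
    congr 1
    · simp [two_mul]
    · rw [← lintegral_indicator measurableSet_Ioi]
      refine lintegral_congr fun r => ?_
      by_cases h : 0 < r
      · by_cases h' : r < 1 <;> simp [Set.indicator, h, h', abs_of_pos h]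
      · simp [Set.indicator, h]
  · have : Measurable fun r : ℝ => (Set.Iio (1 : ℝ)).indicator D |r| :=
      (hD.indicator measurableSet_Iio).comp measurable_norm
    exact (ENNReal.measurable_ofReal.smul this).aemeasurable
  · exact aemeasurable_const

theorem lintegral_bergmanDensity {α β : ℝ} (hα : -1 < α) (hβ : -1 < β) :
    ∫⁻ r in Set.Ioo (0 : ℝ) 1,
      ENNReal.ofReal (2 * Real.pi) * (ENNReal.ofReal r * ENNReal.ofReal (bergmanDensity α β r))
      = 1 := by
  have hα' : 0 < α + 1 := by linarith
  have hβ' : 0 < β + 1 := by linarith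
  have im : (fun r : ℝ => r ^ 2) '' Set.Ioo 0 1 = Set.Ioo 0 1 := by
    ext t
    constructor
    · rintro ⟨r, ⟨h0, h1⟩, rfl⟩
      exact ⟨by positivity, by dsimp; nlinarith⟩
    · rintro ⟨h0, h1⟩
      exact ⟨√t, ⟨Real.sqrt_pos.2 h0, by rw [Real.sqrt_lt' one_pos]; simpa⟩, Real.sq_sqrt h0.le⟩
  rw [← ProbabilityTheory.lintegral_betaPDF_eq_one hβ' hα', ProbabilityTheory.lintegral_betaPDF]
  conv_rhs => rw [← im]
  rw [lintegral_image_eq_lintegral_abs_deriv_mul (f' := fun r => 2 * r) measurableSet_Ioo]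
  · refine setLIntegral_congr_fun measurableSet_Ioo fun r hr => ?_
    have h0 : 0 < r := hr.1
    have hb := ProbabilityTheory.beta_pos hα' hβ'
    rw [← ENNReal.ofReal_mul h0.le, ← ENNReal.ofReal_mul (by positivity),
      ← ENNReal.ofReal_mul (by positivity)]
    congr 1
    have hs : ProbabilityTheory.beta (β + 1) (α + 1) = ProbabilityTheory.beta (α + 1) (β + 1) := by
      unfold ProbabilityTheory.beta
      rw [mul_comm, add_comm (β + 1)]
    have e : r ^ (2 * β) = (r ^ 2) ^ β := by
      rw [← Real.rpow_natCast r 2, ← Real.rpow_mul h0.le]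
      norm_num
    simp only [bergmanDensity]
    rw [abs_of_pos (by positivity), hs, e, add_sub_cancel_right, add_sub_cancel_right]
    field_simp
  · intro x hx
    simpa using (hasDerivAt_pow 2 x).hasDerivWithinAt
  · intro x hx y hy h
    exact (sq_eq_sq₀ hx.1.le hy.1.le).1 h

theorem isProbabilityMeasure_bergmanMeasure {α β : ℝ} (hα : -1 < α) (hβ : -1 < β) :
    IsProbabilityMeasure (bergmanMeasure α β) := by
  constructor
  rw [bergmanMeasure_eq, withDensity_apply _ MeasurableSet.univ, Measure.restrict_univ,
    lintegral_ball_norm (D := fun r => ENNReal.ofReal (bergmanDensity α β r))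
      (ENNReal.measurable_ofReal.comp (measurable_bergmanDensity α β)),
    ← lintegral_const_mul, lintegral_bergmanDensity hα hβ]
  exact ENNReal.measurable_ofReal.mul
    (ENNReal.measurable_ofReal.comp (measurable_bergmanDensity α β))

theorem isOpen_puncturedDisk : IsOpen puncturedDisk :=
  (isOpen_lt continuous_const continuous_norm).inter (isOpen_lt continuous_norm continuous_const)

theorem puncturedDisk_eq : puncturedDisk = Metric.ball (0 : ℂ) 1 \ {0} := by
  ext z
  simp [puncturedDisk, and_comm]

theorem ae_mem_puncturedDisk (α β : ℝ) : ∀ᵐ z ∂bergmanMeasure α β, z ∈ puncturedDisk := by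
  refine (withDensity_absolutelyContinuous _ _).ae_le ?_
  have h0 : ∀ᵐ z ∂(volume.restrict (Metric.ball (0 : ℂ) 1)), z ≠ 0 :=
    ae_restrict_of_ae (Measure.ae_ne _ _)
  filter_upwards [h0, ae_restrict_mem Metric.isOpen_ball.measurableSet] with z h1 h2
  rw [puncturedDisk_eq]
  exact ⟨h2, h1⟩

theorem bergmanMeasure_restrict (α β : ℝ) :
    (bergmanMeasure α β).restrict puncturedDisk = bergmanMeasure α β :=
  Measure.restrict_eq_self_of_ae_mem (ae_mem_puncturedDisk α β)

theorem aestronglyMeasurable_of_continuousOn {E : Type*} [NormedAddCommGroup E] {f : ℂ → E}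
    (hf : ContinuousOn f puncturedDisk) (α β : ℝ) :
    AEStronglyMeasurable f (bergmanMeasure α β) := by
  rw [← bergmanMeasure_restrict]
  exact hf.aestronglyMeasurable isOpen_puncturedDisk.measurableSet

theorem bergmanMeasure_eq_withDensity {α β γ : ℝ} (hα : -1 < α) (hβ : -1 < β) (hγ : -1 < γ) :
    bergmanMeasure α γ = (bergmanMeasure α β).withDensity fun z => ENNReal.ofReal
      (ProbabilityTheory.beta (α + 1) (β + 1) / ProbabilityTheory.beta (α + 1) (γ + 1) *
        ‖z‖ ^ (2 * (γ - β))) := by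
  have hb := ProbabilityTheory.beta_pos (show 0 < α + 1 by linarith) (show 0 < β + 1 by linarith)
  have hc := ProbabilityTheory.beta_pos (show 0 < α + 1 by linarith) (show 0 < γ + 1 by linarith)
  rw [bergmanMeasure_eq, bergmanMeasure_eq, ← withDensity_mul]
  · refine withDensity_congr_ae ?_
    have h0 : ∀ᵐ z ∂(volume.restrict (Metric.ball (0 : ℂ) 1)), z ≠ 0 :=
      ae_restrict_of_ae (Measure.ae_ne _ _)
    filter_upwards [h0, ae_restrict_mem Metric.isOpen_ball.measurableSet] with z h1 h2
    have hz : 0 < ‖z‖ := norm_pos_iff.2 h1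
    have hz1 : ‖z‖ < 1 := by simpa using h2
    rw [Pi.mul_apply, ← ENNReal.ofReal_mul (bergmanDensity_pos hα hβ hz hz1).le]
    congr 1
    unfold bergmanDensity
    rw [show 2 * γ = 2 * β + 2 * (γ - β) by ring, Real.rpow_add hz]
    field_simp
  · exact ENNReal.measurable_ofReal.comp ((measurable_bergmanDensity α β).comp measurable_norm)
  · fun_prop

theorem lintegral_norm_rpow {α β s : ℝ} (hα : -1 < α) (hβ : -1 < β) (hs : -1 < β + s) :
    ∫⁻ z, ENNReal.ofReal (‖z‖ ^ (2 * s)) ∂bergmanMeasure α β = ENNReal.ofReal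
      (ProbabilityTheory.beta (α + 1) (β + s + 1) / ProbabilityTheory.beta (α + 1) (β + 1)) := by
  have hb := ProbabilityTheory.beta_pos (show 0 < α + 1 by linarith) (show 0 < β + 1 by linarith)
  have hc := ProbabilityTheory.beta_pos (show 0 < α + 1 by linarith)
    (show 0 < β + s + 1 by linarith)
  have h := (isProbabilityMeasure_bergmanMeasure hα hs).measure_univ
  rw [bergmanMeasure_eq_withDensity hα hβ hs, withDensity_apply _ MeasurableSet.univ,
    Measure.restrict_univ, add_sub_cancel_left] at h
  simp_rw [ENNReal.ofReal_mul (div_pos hb hc).le] at h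
  rw [lintegral_const_mul _ (by fun_prop)] at h
  have e : ProbabilityTheory.beta (α + 1) (β + s + 1) / ProbabilityTheory.beta (α + 1) (β + 1) =
      (ProbabilityTheory.beta (α + 1) (β + 1) / ProbabilityTheory.beta (α + 1) (β + s + 1))⁻¹ :=
    (inv_div _ _).symm
  rw [e, ENNReal.ofReal_inv_of_pos (div_pos hb hc)]
  exact ENNReal.eq_inv_of_mul_eq_one_left (by rwa [mul_comm])

/-- The Taylor coefficients `(b)_n / (c)_n` of `₂F₁(1, b; c; ·)`. -/
noncomputable def hypergeometricCoeff (b c : ℝ) (n : ℕ) : ℝ :=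
  (ascPochhammer ℝ n).eval b / (ascPochhammer ℝ n).eval c

theorem ordinaryHypergeometricCoefficient_one (b c : ℝ) (n : ℕ) :
    ordinaryHypergeometricCoefficient (1 : ℂ) (b : ℂ) (c : ℂ) n =
      (hypergeometricCoeff b c n : ℂ) := by
  have h : ∀ x : ℝ, (ascPochhammer ℂ n).eval (x : ℂ) = ((ascPochhammer ℝ n).eval x : ℝ) := by
    intro x
    induction n with
    | zero => simp
    | succ k ih => simp [ascPochhammer_succ_eval, ih]
  have hn : (n.factorial : ℂ) ≠ 0 := by exact_mod_cast n.factorial_ne_zero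
  rw [ordinaryHypergeometricCoefficient, h, h, ascPochhammer_eval_one, hypergeometricCoeff]
  push_cast
  rw [inv_mul_cancel₀ hn, one_mul, div_eq_mul_inv]

theorem hypergeometricCoeff_pos {b c : ℝ} (hb : 0 < b) (hc : 0 < c) (n : ℕ) :
    0 < hypergeometricCoeff b c n :=
  div_pos (ascPochhammer_pos n b hb) (ascPochhammer_pos n c hc)

theorem radius_ordinaryHypergeometricSeries {b c : ℝ} (hb : 0 < b) (hc : 0 < c) :
    (ordinaryHypergeometricSeries ℂ (1 : ℂ) (b : ℂ) (c : ℂ)).radius = 1 := by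
  refine ordinaryHypergeometricSeries_radius_eq_one ℂ _ _ _ fun k => ⟨?_, ?_, ?_⟩ <;> intro h <;>
    have h := congrArg Complex.re h <;> simp at h <;> have := k.cast_nonneg (α := ℝ) <;> linarith

theorem summable_hypergeometricCoeff {b c : ℝ} (hb : 0 < b) (hc : 0 < c) {r : ℝ} (h0 : 0 ≤ r)
    (h1 : r < 1) : Summable fun n => hypergeometricCoeff b c n * r ^ n := by
  have h := (ordinaryHypergeometricSeries ℂ (1 : ℂ) (b : ℂ) (c : ℂ)).summable_norm_apply
    (x := (r : ℂ)) (by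
      rw [radius_ordinaryHypergeometricSeries hb hc]
      simpa [← ofReal_norm, abs_of_nonneg h0] using h1)
  refine h.congr fun n => ?_
  rw [ordinaryHypergeometricSeries, FormalMultilinearSeries.ofScalars_apply_eq,
    ordinaryHypergeometricCoefficient_one]
  simp [abs_of_nonneg h0, abs_of_pos (hypergeometricCoeff_pos hb hc n)]

theorem hasSum_ordinaryHypergeometric {b c : ℝ} (hb : 0 < b) (hc : 0 < c) {ξ : ℂ} (h : ‖ξ‖ < 1) :
    HasSum (fun n => (hypergeometricCoeff b c n : ℂ) * ξ ^ n)
      (ordinaryHypergeometric (1 : ℂ) (b : ℂ) (c : ℂ) ξ) := by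
  have := (ordinaryHypergeometricSeries ℂ (1 : ℂ) (b : ℂ) (c : ℂ)).hasSum (x := ξ) (by
      rw [radius_ordinaryHypergeometricSeries hb hc]
      simpa [← ofReal_norm] using h)
  convert! this using 2 with n
  rw [ordinaryHypergeometricSeries, FormalMultilinearSeries.ofScalars_apply_eq,
    ordinaryHypergeometricCoefficient_one, smul_eq_mul]

theorem differentiableOn_ordinaryHypergeometric {b c : ℝ} (hb : 0 < b) (hc : 0 < c) :
    DifferentiableOn ℂ (ordinaryHypergeometric (𝔸 := ℂ) (1 : ℂ) (b : ℂ) (c : ℂ)) (Metric.ball 0 1) := by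
  have := (ordinaryHypergeometricSeries ℂ (1 : ℂ) (b : ℂ) (c : ℂ)).hasFPowerSeriesOnBall (by
      rw [radius_ordinaryHypergeometricSeries hb hc]
      exact one_pos)
  rw [radius_ordinaryHypergeometricSeries hb hc] at this
  rw [← Metric.eball_ofReal, ENNReal.ofReal_one]
  exact this.differentiableOn

theorem norm_ordinaryHypergeometric_le {b c : ℝ} (hb : 0 < b) (hc : 0 < c) {r : ℝ} (h1 : r < 1)
    {ξ : ℂ} (h : ‖ξ‖ ≤ r) :
    ‖ordinaryHypergeometric (1 : ℂ) (b : ℂ) (c : ℂ) ξ‖ ≤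
      ∑' n, hypergeometricCoeff b c n * r ^ n := by
  rw [← (hasSum_ordinaryHypergeometric hb hc (h.trans_lt h1)).tsum_eq]
  refine tsum_of_norm_bounded
    (summable_hypergeometricCoeff hb hc ((norm_nonneg _).trans h) h1).hasSum fun n => ?_
  have := hypergeometricCoeff_pos hb hc n
  rw [norm_mul, norm_pow, Complex.norm_real, Real.norm_of_nonneg this.le]
  gcongr

theorem hypergeometricCoeff_mul_beta {a c : ℝ} (ha : 0 < a) (hc : 0 < c) (n : ℕ) :
    hypergeometricCoeff (a + c) c n * ProbabilityTheory.beta a (c + n) =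
      ProbabilityTheory.beta a c := by
  have key : ∀ x : ℝ, 0 < x → Real.Gamma (x + n) = (ascPochhammer ℝ n).eval x * Real.Gamma x := by
    intro x hx
    induction n with
    | zero => simp
    | succ k ih =>
      rw [ascPochhammer_succ_eval, Nat.cast_succ, ← add_assoc,
        Real.Gamma_add_one (by positivity), ih]
      ring
  have h1 := ascPochhammer_pos n _ (add_pos ha hc)
  have h2 := ascPochhammer_pos n _ hc
  have h3 := Real.Gamma_pos_of_pos (add_pos ha hc)
  unfold ProbabilityTheory.beta hypergeometricCoeff
  rw [← add_assoc, key _ hc, key _ (add_pos ha hc)]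
  field_simp

theorem integrable_norm_rpow {α β s : ℝ} (hα : -1 < α) (hβ : -1 < β) (hs : -1 < β + s) :
    Integrable (fun z : ℂ => ‖z‖ ^ (2 * s)) (bergmanMeasure α β) := by
  refine ⟨(by fun_prop : Measurable _).aestronglyMeasurable, ?_⟩
  rw [hasFiniteIntegral_iff_ofReal (ae_of_all _ fun z => by positivity),
    lintegral_norm_rpow hα hβ hs]
  exact ENNReal.ofReal_lt_top

theorem integral_norm_rpow {α β s : ℝ} (hα : -1 < α) (hβ : -1 < β) (hs : -1 < β + s) :
    ∫ z : ℂ, ‖z‖ ^ (2 * s) ∂bergmanMeasure α β =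
      ProbabilityTheory.beta (α + 1) (β + s + 1) / ProbabilityTheory.beta (α + 1) (β + 1) := by
  have hb := ProbabilityTheory.beta_pos (show 0 < α + 1 by linarith) (show 0 < β + 1 by linarith)
  have hc := ProbabilityTheory.beta_pos (show 0 < α + 1 by linarith)
    (show 0 < β + s + 1 by linarith)
  rw [integral_eq_lintegral_of_nonneg_ae (ae_of_all _ fun z => by positivity)
      (by fun_prop : Measurable _).aestronglyMeasurable,
    lintegral_norm_rpow hα hβ hs, ENNReal.toReal_ofReal (by positivity)]

theorem hypergeometricCoeff_mul_integral {α β : ℝ} (hα : -1 < α) (hβ : -1 < β) (n : ℕ) :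
    hypergeometricCoeff (α + β + 2) (β + 1) n * ∫ z : ℂ, ‖z‖ ^ (2 * n) ∂bergmanMeasure α β = 1 := by
  have hb := ProbabilityTheory.beta_pos (show 0 < α + 1 by linarith) (show 0 < β + 1 by linarith)
  have h := hypergeometricCoeff_mul_beta (show 0 < α + 1 by linarith)
    (show 0 < β + 1 by linarith) n
  have h2 := integral_norm_rpow hα hβ (s := n) (by linarith [n.cast_nonneg (α := ℝ)])
  have e : ∀ z : ℂ, ‖z‖ ^ (2 * (n : ℝ)) = ‖z‖ ^ (2 * n) := fun z => by
    rw [← Real.rpow_natCast]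
    norm_cast
  simp_rw [e] at h2
  rw [h2, ← mul_div_assoc, show α + β + 2 = α + 1 + (β + 1) by ring,
    show β + n + 1 = β + 1 + n by ring, h, div_self hb.ne']

open Real (circleAverage)

theorem setIntegral_Ioo_circleMap (G : ℂ → ℂ) (r : ℝ) :
    ∫ θ in Set.Ioo (-Real.pi) Real.pi, G (circleMap 0 r θ) =
      (2 * Real.pi) • circleAverage G 0 r := by
  have h := ((periodic_circleMap 0 r).comp G).intervalIntegral_add_eq (-Real.pi) 0
  rw [zero_add, show -Real.pi + 2 * Real.pi = Real.pi by ring] at h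
  rw [circleAverage, smul_inv_smul₀ (by positivity), ← integral_Ioc_eq_integral_Ioo,
    ← intervalIntegral.integral_of_le (by linarith [Real.pi_pos])]
  exact h

theorem integrableOn_comp_polarCoord_symm {F : ℂ → ℂ} (hF : Integrable F) :
    IntegrableOn (fun p : ℝ × ℝ => p.1 • F (Complex.polarCoord.symm p)) polarCoord.target := by
  have h1 : Integrable (F ∘ Complex.measurableEquivRealProd.symm) :=
    (Complex.volume_preserving_equiv_real_prod.symm.integrable_comp_emb
      Complex.measurableEquivRealProd.symm.measurableEmbedding).2 hF
  have h2 := h1.integrableOn (s := polarCoord.symm '' polarCoord.target)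
  rw [integrableOn_image_iff_integrableOn_abs_det_fderiv_smul volume
    polarCoord.open_target.measurableSet
    (fun p _ => (hasFDerivAt_polarCoord_symm p).hasFDerivWithinAt) polarCoord.symm.injOn] at h2
  refine h2.congr_fun (fun p hp => ?_) polarCoord.open_target.measurableSet
  rw [polarCoord_target] at hp
  simp only [det_fderivPolarCoordSymm, Function.comp_apply,
    Complex.measurableEquivRealProd_symm_polarCoord_symm_apply]
  rw [abs_of_pos hp.1]

/-- Integration in polar coordinates over a disk. -/
theorem setIntegral_ball_eq_circleAverage {R : ℝ} {G : ℂ → ℂ}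
    (hG : IntegrableOn G (Metric.ball 0 R)) :
    ∫ z in Metric.ball 0 R, G z =
      ∫ r in Set.Ioo 0 R, (2 * Real.pi * r) • circleAverage G 0 r := by
  have hF := (integrable_indicator_iff Metric.isOpen_ball.measurableSet).2 hG
  have hi := integrableOn_comp_polarCoord_symm hF
  rw [← integral_indicator Metric.isOpen_ball.measurableSet,
    ← Complex.integral_comp_polarCoord_symm]
  rw [polarCoord_target, Measure.volume_eq_prod] at hi ⊢
  rw [setIntegral_prod _ hi, ← integral_indicator measurableSet_Ioi,
    ← integral_indicator measurableSet_Ioo]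
  refine integral_congr_ae (ae_of_all _ fun r => ?_)
  by_cases h0 : 0 < r
  · have e : ∀ θ : ℝ, Complex.polarCoord.symm (r, θ) = circleMap 0 r θ := fun θ => by
      rw [Complex.polarCoord_symm_apply, circleMap_zero, Complex.exp_mul_I]
      simp
    by_cases h1 : r < R
    · simp only [Set.indicator, Set.mem_Ioi, h0, if_true, Set.mem_Ioo, h1, and_self, e,
        Metric.mem_ball, dist_zero_right, norm_circleMap_zero, abs_of_pos h0]
      rw [integral_smul, setIntegral_Ioo_circleMap, smul_smul]
      ring_nf
    · simp [Set.indicator, h0, h1, abs_of_pos h0]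
  · simp [Set.indicator, h0]

theorem circleAverage_congr_of_pos {F G : ℂ → ℂ} {r : ℝ} (hr : 0 < r)
    (h : ∀ z : ℂ, ‖z‖ = r → F z = G z) : circleAverage F 0 r = circleAverage G 0 r :=
  Real.circleAverage_congr_sphere fun z hz => h z (by simpa [abs_of_pos hr] using hz)

theorem measurable_ofReal_bergmanDensity (α β : ℝ) :
    Measurable fun z : ℂ => ENNReal.ofReal (bergmanDensity α β ‖z‖) :=
  ENNReal.measurable_ofReal.comp ((measurable_bergmanDensity α β).comp measurable_norm)

theorem integral_bergmanMeasure {α β : ℝ} (hα : -1 < α) (hβ : -1 < β) (G : ℂ → ℂ) :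
    ∫ z, G z ∂bergmanMeasure α β =
      ∫ z in Metric.ball (0 : ℂ) 1, (bergmanDensity α β ‖z‖ : ℂ) * G z := by
  rw [bergmanMeasure_eq, integral_withDensity_eq_integral_toReal_smul
    (measurable_ofReal_bergmanDensity α β)
    (ae_of_all _ fun _ => ENNReal.ofReal_lt_top)]
  refine integral_congr_ae ?_
  have h0 : ∀ᵐ z ∂(volume.restrict (Metric.ball (0 : ℂ) 1)), z ≠ 0 :=
    ae_restrict_of_ae (Measure.ae_ne _ _)
  filter_upwards [h0, ae_restrict_mem Metric.isOpen_ball.measurableSet] with z h1 h2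
  rw [ENNReal.toReal_ofReal (bergmanDensity_pos hα hβ (norm_pos_iff.2 h1) (by simpa using h2)).le]
  simp

theorem integrableOn_of_integrable_bergmanMeasure {α β : ℝ} (hα : -1 < α) (hβ : -1 < β)
    {G : ℂ → ℂ} (h : Integrable G (bergmanMeasure α β)) :
    IntegrableOn (fun z => (bergmanDensity α β ‖z‖ : ℂ) * G z) (Metric.ball (0 : ℂ) 1) := by
  rw [bergmanMeasure_eq, integrable_withDensity_iff_integrable_smul'
    (measurable_ofReal_bergmanDensity α β)
    (ae_of_all _ fun _ => ENNReal.ofReal_lt_top)] at h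
  refine Integrable.congr h ?_
  have h0 : ∀ᵐ z ∂(volume.restrict (Metric.ball (0 : ℂ) 1)), z ≠ 0 :=
    ae_restrict_of_ae (Measure.ae_ne _ _)
  filter_upwards [h0, ae_restrict_mem Metric.isOpen_ball.measurableSet] with z h1 h2
  rw [ENNReal.toReal_ofReal (bergmanDensity_pos hα hβ (norm_pos_iff.2 h1) (by simpa using h2)).le]
  simp

theorem integral_congr_of_circleAverage {α β : ℝ} (hα : -1 < α) (hβ : -1 < β) {F G : ℂ → ℂ}
    (hF : Integrable F (bergmanMeasure α β)) (hG : Integrable G (bergmanMeasure α β))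
    (h : ∀ r, 0 < r → r < 1 → circleAverage F 0 r = circleAverage G 0 r) :
    ∫ z, F z ∂bergmanMeasure α β = ∫ z, G z ∂bergmanMeasure α β := by
  rw [integral_bergmanMeasure hα hβ, integral_bergmanMeasure hα hβ,
    setIntegral_ball_eq_circleAverage (integrableOn_of_integrable_bergmanMeasure hα hβ hF),
    setIntegral_ball_eq_circleAverage (integrableOn_of_integrable_bergmanMeasure hα hβ hG)]
  refine setIntegral_congr_fun measurableSet_Ioo fun r hr => ?_
  have e : ∀ H : ℂ → ℂ, circleAverage (fun z => (bergmanDensity α β ‖z‖ : ℂ) * H z) 0 r =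
      (bergmanDensity α β r : ℂ) * circleAverage H 0 r := fun H => by
    rw [← smul_eq_mul, ← Real.circleAverage_fun_smul]
    exact circleAverage_congr_of_pos hr.1 fun z hz => by rw [hz, smul_eq_mul]
  simp only [e, h r hr.1 hr.2]

theorem circleAverage_mul_conj_pow {g : ℂ → ℂ} (hg : DifferentiableOn ℂ g (Metric.ball 0 1))
    {r : ℝ} (h0 : 0 < r) (h1 : r < 1) (n : ℕ) :
    circleAverage (fun z => g z * (starRingEnd ℂ z) ^ n) 0 r =
      (r ^ (2 * n) : ℝ) * ((n.factorial : ℂ)⁻¹ * iteratedDeriv n g 0) := by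
  have h := (hg.mono (Metric.closedBall_subset_ball h1)).circleIntegral_one_div_sub_center_pow_smul
    h0 n
  have e : circleAverage (fun z => g z * (starRingEnd ℂ z) ^ n) 0 r =
      circleAverage (fun z => ((r ^ (2 * n) : ℝ) : ℂ) • ((z ^ n)⁻¹ * g z)) 0 r := by
    refine circleAverage_congr_of_pos h0 fun z hz => ?_
    have hz0 : z ≠ 0 := norm_pos_iff.1 (by rwa [hz])
    have h2 : (starRingEnd ℂ z) ^ n * z ^ n = ((r ^ (2 * n) : ℝ) : ℂ) := by
      rw [← mul_pow, mul_comm, Complex.mul_conj, Complex.normSq_eq_norm_sq, hz, pow_mul]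
      push_cast
      rfl
    rw [← h2, smul_eq_mul]
    field_simp
  rw [e, Real.circleAverage_fun_smul, smul_eq_mul, Real.circleAverage_eq_circleIntegral h0.ne']
  congr 1
  have e2 : (∮ z in C(0, r), (z - 0)⁻¹ • ((z ^ n)⁻¹ * g z)) =
      ∮ z in C(0, r), (1 / (z - 0) ^ (n + 1)) • g z := by
    congr 1
    funext z
    simp only [sub_zero, smul_eq_mul, pow_succ, one_div, mul_inv]
    ring
  rw [e2, h, smul_eq_mul, smul_eq_mul]
  field_simp [Complex.two_pi_I_ne_zero]

theorem integral_mul_conj_pow {α β : ℝ} (hα : -1 < α) (hβ : -1 < β) {g : ℂ → ℂ}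
    (hg : DifferentiableOn ℂ g (Metric.ball 0 1)) (hi : Integrable g (bergmanMeasure α β)) (n : ℕ) :
    Integrable (fun z => g z * (starRingEnd ℂ z) ^ n) (bergmanMeasure α β) ∧
    ∫ z, g z * (starRingEnd ℂ z) ^ n ∂bergmanMeasure α β =
      ((n.factorial : ℂ)⁻¹ * iteratedDeriv n g 0) *
        (∫ z : ℂ, ‖z‖ ^ (2 * n) ∂bergmanMeasure α β : ℝ) := by
  have := isProbabilityMeasure_bergmanMeasure hα hβ
  have h1 : Integrable (fun z => g z * (starRingEnd ℂ z) ^ n) (bergmanMeasure α β) := by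
    refine hi.mul_bdd (c := 1) (Continuous.aestronglyMeasurable (by fun_prop)) ?_
    filter_upwards [ae_mem_puncturedDisk α β] with z hz
    simpa using pow_le_one₀ (norm_nonneg z) hz.2.le
  refine ⟨h1, ?_⟩
  have h2 : Integrable (fun z : ℂ => ‖z‖ ^ (2 * n)) (bergmanMeasure α β) := by
    refine Integrable.of_bound (C := 1) (Continuous.aestronglyMeasurable (by fun_prop)) ?_
    filter_upwards [ae_mem_puncturedDisk α β] with z hz
    simpa using pow_le_one₀ (norm_nonneg z) hz.2.le
  rw [← integral_complex_ofReal, ← integral_const_mul]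
  refine integral_congr_of_circleAverage hα hβ h1 (h2.ofReal.const_mul _) fun r h0 h1 => ?_
  rw [circleAverage_mul_conj_pow hg h0 h1, mul_comm]
  symm
  refine Real.circleAverage_const_on_circle fun z hz => ?_
  have hz : ‖z‖ = r := by simpa [abs_of_pos h0] using hz
  rw [hz]

/-- Area mean value property of holomorphic functions on a disk around the origin. -/
theorem setIntegral_ball_eq {h : ℂ → ℂ} {ρ : ℝ} (hρ : 0 < ρ)
    (hh : DifferentiableOn ℂ h (Metric.closedBall 0 ρ)) :
    ∫ z in Metric.ball 0 ρ, h z = (Real.pi * ρ ^ 2) • h 0 := by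
  have hi : IntegrableOn h (Metric.ball 0 ρ) :=
    (hh.continuousOn.integrableOn_compact (isCompact_closedBall _ _)).mono_set
      Metric.ball_subset_closedBall
  rw [setIntegral_ball_eq_circleAverage hi]
  have e : ∀ r ∈ Set.Ioo 0 ρ, (2 * Real.pi * r) • circleAverage h 0 r =
      (2 * Real.pi * r) • h 0 := fun r hr => by
    have hd : DiffContOnCl ℂ h (Metric.ball 0 |r|) := by
      rw [abs_of_pos hr.1]
      exact (hh.mono (Metric.closedBall_subset_closedBall hr.2.le)).diffContOnCl_ball subset_rfl
    rw [hd.circleAverage]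
  rw [setIntegral_congr_fun measurableSet_Ioo e, integral_smul_const,
    ← integral_Ioc_eq_integral_Ioo, ← intervalIntegral.integral_of_le hρ.le,
    intervalIntegral.integral_const_mul, integral_id]
  congr 1
  ring

theorem norm_mul_le_setIntegral_ball {h : ℂ → ℂ} {z : ℂ} {ρ : ℝ} (hρ : 0 < ρ)
    (hh : DifferentiableOn ℂ h (Metric.closedBall z ρ)) :
    Real.pi * ρ ^ 2 * ‖h z‖ ≤ ∫ w in Metric.ball z ρ, ‖h w‖ := by
  have h1 : DifferentiableOn ℂ (fun w => h (w + z)) (Metric.closedBall 0 ρ) :=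
    hh.comp (by fun_prop) fun w hw => by simpa using hw
  have h2 := setIntegral_ball_eq hρ h1
  have e : ∫ w in Metric.ball 0 ρ, ‖h (w + z)‖ = ∫ w in Metric.ball z ρ, ‖h w‖ := by
    have := (measurePreserving_add_right (volume : Measure ℂ) z).setIntegral_preimage_emb
      (measurableEmbedding_addRight z) (fun w => ‖h w‖) (Metric.ball z ρ)
    rw [← this]
    congr 2
    ext w
    simp
  rw [zero_add] at h2
  rw [← e]
  refine le_trans (le_of_eq ?_) (norm_integral_le_integral_norm _)
  rw [h2, norm_smul, Real.norm_of_nonneg (by positivity)]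

/-- A singularity near which a holomorphic function is square integrable is removable. -/
theorem exists_differentiableOn_extension {g : ℂ → ℂ} (hg : DifferentiableOn ℂ g puncturedDisk)
    (hi : IntegrableOn (fun z => ‖g z‖ ^ 2) (Metric.ball 0 (1 / 2) \ {0})) :
    ∃ G, DifferentiableOn ℂ G (Metric.ball 0 1) ∧ Set.EqOn G g puncturedDisk := by
  refine ⟨Function.update g 0 (limUnder (𝓝[≠] 0) g), ?_, fun z hz =>
    Function.update_of_ne (norm_pos_iff.1 hz.1) _ _⟩
  refine Complex.differentiableOn_update_limUnder_of_isLittleO (Metric.ball_mem_nhds 0 one_pos)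
    (by rwa [← puncturedDisk_eq]) ?_
  set S : Set ℂ := Metric.ball 0 (1 / 2) \ {0}
  have hI : Tendsto (fun z : ℂ => ∫ w in Metric.ball 0 (2 * ‖z‖), ‖g w‖ ^ 2
      ∂(volume.restrict S)) (𝓝[≠] 0) (𝓝 0) := by
    refine Integrable.tendsto_setIntegral_nhds_zero hi ?_
    refine tendsto_of_tendsto_of_tendsto_of_le_of_le tendsto_const_nhds
      (h := fun z : ℂ => volume (Metric.ball (0 : ℂ) (2 * ‖z‖))) ?_ (fun _ => zero_le)
      fun z => Measure.restrict_apply_le _ _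
    simp only [Complex.volume_ball]
    have : Tendsto (fun z : ℂ => ENNReal.ofReal (2 * ‖z‖) ^ 2 * NNReal.pi) (𝓝 0)
        (𝓝 (ENNReal.ofReal (2 * ‖(0 : ℂ)‖) ^ 2 * NNReal.pi)) := by
      refine ENNReal.Tendsto.mul_const ?_ (Or.inr (by simp))
      exact ((ENNReal.continuous_pow 2).comp (ENNReal.continuous_ofReal.comp
        (by fun_prop : Continuous fun z : ℂ => 2 * ‖z‖))).tendsto _
    simpa using this.mono_left nhdsWithin_le_nhds
  have hbound : ∀ᶠ z in 𝓝[≠] (0 : ℂ), ‖g z * z‖ ≤ √(4 / Real.pi *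
      ∫ w in Metric.ball 0 (2 * ‖z‖), ‖g w‖ ^ 2 ∂(volume.restrict S)) := by
    have h4 : Metric.ball (0 : ℂ) (1 / 4) ∈ 𝓝[≠] (0 : ℂ) :=
      mem_nhdsWithin_of_mem_nhds (Metric.ball_mem_nhds 0 (by norm_num))
    filter_upwards [h4, self_mem_nhdsWithin] with z hz hz0
    have hzp : 0 < ‖z‖ := norm_pos_iff.2 hz0
    have hz4 : ‖z‖ < 1 / 4 := by simpa using hz
    have hw : ∀ w ∈ Metric.closedBall z (‖z‖ / 2), ‖z‖ / 2 ≤ ‖w‖ ∧ ‖w‖ ≤ 3 / 2 * ‖z‖ := by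
      intro w hw
      rw [mem_closedBall_iff_norm] at hw
      have h1 := norm_sub_norm_le w z
      have h2 := norm_sub_norm_le z w
      rw [norm_sub_rev] at h2
      constructor <;> linarith
    have hd : DifferentiableOn ℂ (fun w => g w ^ 2) (Metric.closedBall z (‖z‖ / 2)) :=
      (hg.mono fun w h => ⟨by linarith [(hw w h).1], by linarith [(hw w h).2]⟩).pow 2
    have h := norm_mul_le_setIntegral_ball (half_pos hzp) hd
    simp only [norm_pow] at h
    have hsub : Metric.ball z (‖z‖ / 2) ⊆ Metric.ball 0 (2 * ‖z‖) ∩ S := by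
      intro w h
      have := hw w (Metric.ball_subset_closedBall h)
      refine ⟨by simp; linarith, by simp; linarith, ?_⟩
      exact norm_pos_iff.1 (by linarith)
    have h' : ∫ w in Metric.ball z (‖z‖ / 2), ‖g w‖ ^ 2 ≤
        ∫ w in Metric.ball 0 (2 * ‖z‖), ‖g w‖ ^ 2 ∂(volume.restrict S) := by
      rw [Measure.restrict_restrict Metric.isOpen_ball.measurableSet]
      exact setIntegral_mono_set (hi.mono_set Set.inter_subset_right)
        (ae_of_all _ fun _ => by positivity) hsub.eventuallyLE
    refine Real.le_sqrt_of_sq_le ?_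
    rw [norm_mul, mul_pow]
    have h3 := h.trans h'
    rw [div_mul_eq_mul_div, le_div_iff₀ Real.pi_pos]
    nlinarith
  have hz : Tendsto (fun z => g z * z) (𝓝[≠] 0) (𝓝 0) := by
    rw [tendsto_zero_iff_norm_tendsto_zero]
    refine tendsto_of_tendsto_of_tendsto_of_le_of_le' tendsto_const_nhds ?_
      (Eventually.of_forall fun _ => norm_nonneg _) hbound
    simpa using (hI.const_mul (4 / Real.pi)).sqrt
  rw [Asymptotics.isLittleO_iff_tendsto']
  · have hc : Tendsto (fun z : ℂ => g 0 * z) (𝓝[≠] 0) (𝓝 0) := by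
      have : Tendsto (fun z : ℂ => g 0 * z) (𝓝 0) (𝓝 (g 0 * 0)) :=
        Continuous.tendsto (by fun_prop) _
      simpa using this.mono_left nhdsWithin_le_nhds
    simpa [sub_mul] using hz.sub hc
  · filter_upwards [self_mem_nhdsWithin] with z hz h
    simp at h
    exact absurd h hz

/-- The reproducing formula for holomorphic functions on the whole disk. -/
theorem integral_mul_conj_ordinaryHypergeometric {α β : ℝ} (hα : -1 < α) (hβ : -1 < β) {g : ℂ → ℂ}
    (hg : DifferentiableOn ℂ g (Metric.ball 0 1)) (hi : Integrable g (bergmanMeasure α β)) {z : ℂ}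
    (hz : ‖z‖ < 1) :
    ∫ w, g w * starRingEnd ℂ (ordinaryHypergeometric (1 : ℂ) ((α + β + 2 : ℝ) : ℂ)
      ((β + 1 : ℝ) : ℂ) (w * starRingEnd ℂ z)) ∂bergmanMeasure α β = g z := by
  have hb : 0 < α + β + 2 := by linarith
  have hc : 0 < β + 1 := by linarith
  set c := hypergeometricCoeff (α + β + 2) (β + 1) with hcdef
  have hcp : ∀ n, 0 < c n := hypergeometricCoeff_pos hb hc
  let F : ℕ → ℂ → ℂ := fun n w => ((c n : ℂ) * z ^ n) * (g w * (starRingEnd ℂ w) ^ n)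
  have hF : ∀ n, Integrable (F n) (bergmanMeasure α β) := fun n =>
    (integral_mul_conj_pow hα hβ hg hi n).1.const_mul _
  have hFi : ∀ n, ∫ w, F n w ∂bergmanMeasure α β =
      (n.factorial : ℂ)⁻¹ • (z - 0) ^ n • iteratedDeriv n g 0 := fun n => by
    have h1 : ((c n : ℝ) : ℂ) * (∫ z : ℂ, ‖z‖ ^ (2 * n) ∂bergmanMeasure α β : ℝ) = 1 := by
      exact_mod_cast hypergeometricCoeff_mul_integral hα hβ n
    simp only [F]
    rw [integral_const_mul, (integral_mul_conj_pow hα hβ hg hi n).2, smul_eq_mul, smul_eq_mul,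
      sub_zero]
    linear_combination (z ^ n * ((n.factorial : ℂ)⁻¹ * iteratedDeriv n g 0)) * h1
  have hsum : Summable fun n => ∫ w, ‖F n w‖ ∂bergmanMeasure α β := by
    refine Summable.of_nonneg_of_le (fun n => integral_nonneg fun _ => norm_nonneg _) (fun n => ?_)
      ((summable_hypergeometricCoeff hb hc (norm_nonneg z) hz).mul_right
        (∫ w, ‖g w‖ ∂bergmanMeasure α β))
    rw [← integral_const_mul]
    refine integral_mono_ae (hF n).norm (hi.norm.const_mul _) ?_
    filter_upwards [ae_mem_puncturedDisk α β] with w hw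
    have hw1 : ‖w‖ ^ n ≤ 1 := pow_le_one₀ (norm_nonneg w) hw.2.le
    have h0 := (hcp n).le
    simp only [F, norm_mul, norm_pow, Complex.norm_real, RCLike.norm_conj,
      Real.norm_of_nonneg h0]
    exact mul_le_mul_of_nonneg_left (mul_le_of_le_one_right (norm_nonneg _) hw1) (by positivity)
  have h := hasSum_integral_of_summable_integral_norm hF hsum
  simp only [hFi] at h
  have h' := Complex.hasSum_taylorSeries_on_ball hg (z := z) (by simpa using hz)
  rw [← h.unique h']
  refine integral_congr_ae ?_
  filter_upwards [ae_mem_puncturedDisk α β] with w hw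
  have hξ : ‖w * starRingEnd ℂ z‖ < 1 := by
    rw [norm_mul, RCLike.norm_conj]
    exact mul_lt_one_of_nonneg_of_lt_one_left (norm_nonneg _) hw.2 hz.le
  have hs := ((hasSum_ordinaryHypergeometric hb hc hξ).map (starRingEnd ℂ)
    Complex.continuous_conj).mul_left (g w)
  rw [← hs.tsum_eq]
  refine tsum_congr fun n => ?_
  simp only [F, Function.comp_apply, map_mul, map_pow, Complex.conj_conj, Complex.conj_ofReal]
  rw [← hcdef]
  ring

section changeOfWeight

variable {E : Type*} [NormedAddCommGroup E] [NormedSpace ℝ E] {α β : ℝ} {m : ℕ}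

theorem bergmanMeasure_sub_natCast (hα : -1 < α) (hβ : -1 < β) (hm : -1 < β - m) :
    bergmanMeasure α (β - m) = (bergmanMeasure α β).withDensity fun z => ENNReal.ofReal
      (ProbabilityTheory.beta (α + 1) (β + 1) / ProbabilityTheory.beta (α + 1) (β - m + 1) *
        (‖z‖ ^ (2 * m))⁻¹) := by
  rw [bergmanMeasure_eq_withDensity hα hβ hm]
  congr 1
  funext z
  rw [show 2 * (β - m - β) = -((2 * m : ℕ) : ℝ) by push_cast; ring, Real.rpow_neg (norm_nonneg z),
    Real.rpow_natCast]

theorem changeOfWeight_pos (hα : -1 < α) (hβ : -1 < β) (hm : -1 < β - m) :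
    0 < ProbabilityTheory.beta (α + 1) (β + 1) / ProbabilityTheory.beta (α + 1) (β - m + 1) :=
  div_pos (ProbabilityTheory.beta_pos (by linarith) (by linarith))
    (ProbabilityTheory.beta_pos (by linarith) (by linarith))

theorem integrable_bergmanMeasure_sub_iff (hα : -1 < α) (hβ : -1 < β) (hm : -1 < β - m)
    {h : ℂ → E} : Integrable h (bergmanMeasure α (β - m)) ↔
      Integrable (fun z => (ProbabilityTheory.beta (α + 1) (β + 1) /
        ProbabilityTheory.beta (α + 1) (β - m + 1) * (‖z‖ ^ (2 * m))⁻¹) • h z)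
        (bergmanMeasure α β) := by
  rw [bergmanMeasure_sub_natCast hα hβ hm, integrable_withDensity_iff_integrable_smul'
    (by fun_prop) (ae_of_all _ fun _ => ENNReal.ofReal_lt_top)]
  refine integrable_congr (ae_of_all _ fun z => ?_)
  have := changeOfWeight_pos hα hβ hm
  dsimp only
  rw [ENNReal.toReal_ofReal (by positivity)]

theorem integral_bergmanMeasure_sub (hα : -1 < α) (hβ : -1 < β) (hm : -1 < β - m) (h : ℂ → E) :
    ∫ z, h z ∂bergmanMeasure α (β - m) =
      ∫ z, (ProbabilityTheory.beta (α + 1) (β + 1) /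
        ProbabilityTheory.beta (α + 1) (β - m + 1) * (‖z‖ ^ (2 * m))⁻¹) • h z
        ∂bergmanMeasure α β := by
  rw [bergmanMeasure_sub_natCast hα hβ hm, integral_withDensity_eq_integral_toReal_smul
    (by fun_prop) (ae_of_all _ fun _ => ENNReal.ofReal_lt_top)]
  refine integral_congr_ae (ae_of_all _ fun z => ?_)
  have := changeOfWeight_pos hα hβ hm
  dsimp only
  rw [ENNReal.toReal_ofReal (by positivity)]

end changeOfWeight

theorem bergmanDensity_ge {α β r : ℝ} (hα : -1 < α) (hβ : -1 < β) (hβ0 : β ≤ 0) (h0 : 0 < r)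
    (h1 : r < 1 / 2) :
    (ProbabilityTheory.beta (α + 1) (β + 1))⁻¹ * min 1 ((3 / 4) ^ α) * Real.pi⁻¹ ≤
      bergmanDensity α β r := by
  have := ProbabilityTheory.beta_pos (show 0 < α + 1 by linarith) (show 0 < β + 1 by linarith)
  have h2 : 3 / 4 ≤ 1 - r ^ 2 := by nlinarith
  have h3 : 1 ≤ r ^ (2 * β) :=
    Real.one_le_rpow_of_pos_of_le_one_of_nonpos h0 (by linarith) (by linarith)
  have h4 : min 1 ((3 / 4) ^ α) ≤ (1 - r ^ 2) ^ α := by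
    rcases le_total 0 α with h | h
    · exact (min_le_right _ _).trans (Real.rpow_le_rpow (by norm_num) h2 h)
    · exact (min_le_left _ _).trans
        (Real.one_le_rpow_of_pos_of_le_one_of_nonpos (by linarith) (by nlinarith) h)
  have h5 : min 1 ((3 / 4) ^ α) ≤ r ^ (2 * β) * (1 - r ^ 2) ^ α :=
    h4.trans (le_mul_of_one_le_left (Real.rpow_nonneg (by linarith) _) h3)
  unfold bergmanDensity
  gcongr

/-- For `β ≤ 0`, square integrable holomorphic functions on `𝔻*` extend to the disk. -/
theorem exists_extension_of_integrable_sq {α β : ℝ} (hα : -1 < α) (hβ : -1 < β) (hβ0 : β ≤ 0)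
    {g : ℂ → ℂ} (hg : DifferentiableOn ℂ g puncturedDisk)
    (hi : Integrable (fun z => ‖g z‖ ^ 2) (bergmanMeasure α β)) :
    ∃ G, DifferentiableOn ℂ G (Metric.ball 0 1) ∧ Set.EqOn G g puncturedDisk := by
  refine exists_differentiableOn_extension hg ?_
  have hb := ProbabilityTheory.beta_pos (show 0 < α + 1 by linarith) (show 0 < β + 1 by linarith)
  set c := (ProbabilityTheory.beta (α + 1) (β + 1))⁻¹ * min 1 ((3 / 4) ^ α) * Real.pi⁻¹ with hc
  have hcp : 0 < c := by positivity
  have hS : MeasurableSet (Metric.ball (0 : ℂ) (1 / 2) \ {0}) :=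
    Metric.isOpen_ball.measurableSet.diff (measurableSet_singleton 0)
  have hsub : Metric.ball (0 : ℂ) (1 / 2) \ {0} ⊆ puncturedDisk := by
    rw [puncturedDisk_eq]
    exact Set.sdiff_subset_sdiff_left (Metric.ball_subset_ball (by norm_num))
  have h1 : IntegrableOn (fun z => (bergmanDensity α β ‖z‖ : ℂ) * ((‖g z‖ ^ 2 : ℝ) : ℂ))
      (Metric.ball (0 : ℂ) (1 / 2) \ {0}) :=
    (integrableOn_of_integrable_bergmanMeasure hα hβ hi.ofReal).mono_set (Set.sdiff_subset.trans (Metric.ball_subset_ball (by norm_num)))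
  refine (h1.norm.const_mul c⁻¹).mono' ?_ ?_
  · exact ((hg.continuousOn.mono hsub).norm.pow 2).aestronglyMeasurable hS
  · filter_upwards [ae_restrict_mem hS] with z hz
    have h2 := bergmanDensity_ge hα hβ hβ0 (norm_pos_iff.2 hz.2) (by simpa using hz.1)
    rw [← hc] at h2
    rw [norm_mul, Complex.norm_real, Real.norm_of_nonneg (hcp.le.trans h2),
      Complex.norm_real, ← mul_assoc, norm_pow, norm_norm]
    refine le_mul_of_one_le_left (by positivity) ?_
    rwa [← div_eq_inv_mul, one_le_div hcp]

theorem bergmanKernel_eq (α β : ℝ) (w z : ℂ) :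
    bergmanKernel α β w z =
      ((ProbabilityTheory.beta (α + 1) (β + 1) /
        ProbabilityTheory.beta (α + 1) (β - poleOrder β + 1) : ℝ) : ℂ) *
      ((w * starRingEnd ℂ z) ^ poleOrder β)⁻¹ *
      ordinaryHypergeometric (1 : ℂ) ((α + (β - poleOrder β) + 2 : ℝ) : ℂ)
        ((β - poleOrder β + 1 : ℝ) : ℂ) (w * starRingEnd ℂ z) := rfl

theorem exists_norm_bergmanKernel_le {α β : ℝ} (hα : -1 < α) (hβ : -1 < β) {r : ℝ} (hr : r < 1) :
    ∃ C, 0 ≤ C ∧ ∀ w z : ℂ, ‖w‖ * ‖z‖ ≤ r →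
      ‖bergmanKernel α β w z‖ ≤ C * ((‖w‖ * ‖z‖) ^ poleOrder β)⁻¹ := by
  obtain ⟨hm, -⟩ := poleOrder_spec hβ
  have hc := changeOfWeight_pos hα hβ hm
  refine ⟨ProbabilityTheory.beta (α + 1) (β + 1) /
    ProbabilityTheory.beta (α + 1) (β - poleOrder β + 1) *
    max 0 (∑' n, hypergeometricCoeff (α + (β - poleOrder β) + 2) (β - poleOrder β + 1) n * r ^ n),
    by positivity, fun w z h => ?_⟩
  have h' : ‖w * starRingEnd ℂ z‖ ≤ r := by rwa [norm_mul, RCLike.norm_conj]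
  have h1 := norm_ordinaryHypergeometric_le (b := α + (β - poleOrder β) + 2)
    (c := β - poleOrder β + 1) (by linarith) (by linarith) hr h'
  rw [bergmanKernel_eq, norm_mul, norm_mul, Complex.norm_real, Real.norm_of_nonneg hc.le, norm_inv,
    norm_pow, norm_mul, RCLike.norm_conj, mul_right_comm]
  gcongr
  exact h1.trans (le_max_right _ _)

theorem differentiableOn_bergmanKernel {α β : ℝ} (hα : -1 < α) (hβ : -1 < β) {z : ℂ}
    (hz : z ∈ puncturedDisk) :
    DifferentiableOn ℂ (fun w => bergmanKernel α β w z) puncturedDisk := by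
  obtain ⟨hm, -⟩ := poleOrder_spec hβ
  have hd := differentiableOn_ordinaryHypergeometric (b := α + (β - poleOrder β) + 2)
    (c := β - poleOrder β + 1) (by linarith) (by linarith)
  have hl : DifferentiableOn ℂ (fun w : ℂ => w * starRingEnd ℂ z) puncturedDisk := by fun_prop
  simp only [bergmanKernel_eq]
  refine (((hl.pow _).inv fun w hw => ?_).const_mul _).mul (hd.comp hl fun w hw => ?_)
  · exact pow_ne_zero _ (mul_ne_zero (norm_pos_iff.1 hw.1)
      ((map_ne_zero _).2 (norm_pos_iff.1 hz.1)))
  · simpa using mul_lt_one_of_nonneg_of_lt_one_left (norm_nonneg _) hw.2 hz.2.le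

theorem memLp_norm_pow_inv {α β p : ℝ} (hα : -1 < α) (hβ : -1 < β) (hp : 0 < p) {m : ℕ}
    (h : m * p < 2 * (β + 1)) :
    MemLp (fun w : ℂ => (‖w‖ ^ m)⁻¹) (ENNReal.ofReal p) (bergmanMeasure α β) := by
  rw [← integrable_norm_rpow_iff (by fun_prop : Measurable _).aestronglyMeasurable
    (by simpa using hp) ENNReal.ofReal_ne_top, ENNReal.toReal_ofReal hp.le]
  refine (integrable_norm_rpow hα hβ (s := -(m * p / 2)) (by linarith)).congr
    (ae_of_all _ fun w => ?_)
  dsimp only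
  rw [norm_inv, norm_pow, norm_norm, Real.inv_rpow (by positivity), ← Real.rpow_natCast,
    ← Real.rpow_mul (norm_nonneg _), ← Real.rpow_neg (norm_nonneg _)]
  congr 1
  ring

theorem memBergman_bergmanKernel {α β p : ℝ} (hα : -1 < α) (hβ : -1 < β) (hp : 0 < p)
    (h : poleOrder β * p < 2 * (β + 1)) {z : ℂ} (hz : z ∈ puncturedDisk) :
    MemBergman α β p (fun w => bergmanKernel α β w z) := by
  have hd := differentiableOn_bergmanKernel hα hβ hz
  refine ⟨hd, ?_⟩
  obtain ⟨C, hC, hK⟩ := exists_norm_bergmanKernel_le hα hβ hz.2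
  refine ((memLp_norm_pow_inv hα hβ hp h).const_mul (C * (‖z‖ ^ poleOrder β)⁻¹)).mono'
    (aestronglyMeasurable_of_continuousOn hd.continuousOn α β) ?_
  filter_upwards [ae_mem_puncturedDisk α β] with w hw
  refine (hK w z (mul_le_of_le_one_left (norm_nonneg _) hw.2.le)).trans (le_of_eq ?_)
  rw [mul_pow, mul_inv]
  ring

theorem isReproducingKernel_bergmanKernel {α β : ℝ} (hα : -1 < α) (hβ : -1 < β) :
    IsReproducingKernel α β (bergmanKernel α β) := by
  obtain ⟨hm, hm0⟩ := poleOrder_spec hβ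
  intro z hz
  refine ⟨memBergman_bergmanKernel hα hβ two_pos (by linarith) hz, fun f hf => ?_⟩
  set m := poleOrder β with hmdef
  have hc := changeOfWeight_pos hα hβ hm
  set c := ProbabilityTheory.beta (α + 1) (β + 1) / ProbabilityTheory.beta (α + 1) (β - m + 1)
    with hcdef
  have := isProbabilityMeasure_bergmanMeasure hα hm
  have hgd : DifferentiableOn ℂ (fun w => w ^ m * f w) puncturedDisk :=
    (differentiableOn_id.pow m).mul hf.1
  have hgi : Integrable (fun w => ‖w ^ m * f w‖ ^ 2) (bergmanMeasure α (β - m)) := by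
    rw [integrable_bergmanMeasure_sub_iff hα hβ hm]
    have h2 := (hf.2.integrable_norm_rpow (by simp) ENNReal.ofReal_ne_top).const_mul c
    refine h2.congr ?_
    filter_upwards [ae_mem_puncturedDisk α β] with w hw
    have hw0 := hw.1
    rw [ENNReal.toReal_ofReal zero_le_two, Real.rpow_two, smul_eq_mul, norm_mul, norm_pow, ← hcdef]
    field_simp
    ring
  obtain ⟨G, hG, hGe⟩ := exists_extension_of_integrable_sq hα hm hm0 hgd hgi
  have hGi : Integrable G (bergmanMeasure α (β - m)) := by
    have h1 : MemLp (fun w => w ^ m * f w) 2 (bergmanMeasure α (β - m)) :=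
      (memLp_two_iff_integrable_sq_norm
        (aestronglyMeasurable_of_continuousOn hgd.continuousOn _ _)).2 hgi
    refine (h1.integrable one_le_two).congr ?_
    filter_upwards [ae_mem_puncturedDisk α (β - m)] with w hw using (hGe hw).symm
  have hz0 : z ^ m ≠ 0 := pow_ne_zero _ (norm_pos_iff.1 hz.1)
  have key := integral_mul_conj_ordinaryHypergeometric hα hm hG hGi hz.2
  rw [hGe hz, integral_bergmanMeasure_sub hα hβ hm, ← hcdef] at key
  dsimp only at key
  rw [← mul_right_inj' hz0, ← key, ← integral_const_mul]
  refine integral_congr_ae ?_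
  filter_upwards [ae_mem_puncturedDisk α β] with w hw
  have hw0 : w ≠ 0 := norm_pos_iff.1 hw.1
  have hw1 : starRingEnd ℂ w ≠ 0 := (map_ne_zero _).2 hw0
  have hn : ((‖w‖ ^ (2 * m) : ℝ) : ℂ) = w ^ m * (starRingEnd ℂ w) ^ m := by
    rw [← mul_pow, Complex.mul_conj, Complex.normSq_eq_norm_sq, pow_mul]
    push_cast
    rfl
  rw [hGe hw, bergmanKernel_eq, ← hmdef, ← hcdef, Complex.real_smul, Complex.ofReal_mul,
    Complex.ofReal_inv, hn]
  simp only [map_mul, map_inv₀, map_pow, mul_pow, Complex.conj_conj, Complex.conj_ofReal]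
  field_simp

end ModifiedBergman

open scoped ENNReal

/-- If adding a unimodular multiple of `x i` to a fixed vector asymptotically increases the `p`-th
power of its norm by at most one, as for disjoint supports in `L^p`, then `x i → 0` weakly. -/
theorem tendsto_apply_of_eventually_norm_add_le {E ι : Type*} [NormedAddCommGroup E]
    [NormedSpace ℂ E] {l : Filter ι} {x : ι → E} {p : ℝ} (hp : 1 < p)
    (h : ∀ (v : E) (ε : ℝ), 0 < ε → ∀ᶠ i in l, ∀ c : ℂ, ‖c‖ ≤ 1 →
      ‖v + c • x i‖ ≤ (‖v‖ ^ p + 1) ^ (1 / p) + ε) (φ : E →L[ℂ] ℂ) :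
    Tendsto (fun i => φ (x i)) l (𝓝 0) := by
  have hp0 : 0 < p := one_pos.trans hp
  by_contra hcon
  obtain ⟨ε, hε, hfr⟩ : ∃ ε > 0, ∃ᶠ i in l, ε ≤ ‖φ (x i)‖ := by
    rw [Metric.tendsto_nhds] at hcon
    push Not at hcon
    simpa using hcon
  have hN : ∀ N : ℕ, ∃ v : E, ‖v‖ ^ p ≤ 2 * N ∧ N * ε ≤ (φ v).re := by
    intro N
    induction N with
    | zero => exact ⟨0, by simp [Real.zero_rpow hp0.ne'], by simp⟩
    | succ N ih =>
      obtain ⟨v, hv, hφ⟩ := ih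
      have hδ : 0 < (2 * N + 2 : ℝ) ^ (1 / p) - (2 * N + 1 : ℝ) ^ (1 / p) :=
        sub_pos.2 (Real.rpow_lt_rpow (by positivity) (by linarith) (by positivity))
      obtain ⟨i, hi, hi'⟩ := (hfr.and_eventually (h v _ hδ)).exists
      have hpos : 0 < ‖φ (x i)‖ := hε.trans_le hi
      refine ⟨v + (starRingEnd ℂ (φ (x i)) * (‖φ (x i)‖⁻¹ : ℝ)) • x i, ?_, ?_⟩
      · have h1 := hi' (starRingEnd ℂ (φ (x i)) * (‖φ (x i)‖⁻¹ : ℝ)) (by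
          rw [norm_mul, RCLike.norm_conj, Complex.norm_real, norm_inv, norm_norm,
            mul_inv_cancel₀ hpos.ne'])
        have h2 : (‖v‖ ^ p + 1) ^ (1 / p) ≤ (2 * N + 1 : ℝ) ^ (1 / p) :=
          Real.rpow_le_rpow (by positivity) (by linarith) (by positivity)
        calc _ ≤ ((2 * N + 2 : ℝ) ^ (1 / p)) ^ p :=
              Real.rpow_le_rpow (norm_nonneg _) (by linarith) hp0.le
          _ = 2 * (N + 1 : ℕ) := by
              rw [← Real.rpow_mul (by positivity), one_div_mul_cancel hp0.ne', Real.rpow_one]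
              push_cast
              ring
      · have h1 : φ ((starRingEnd ℂ (φ (x i)) * (‖φ (x i)‖⁻¹ : ℝ)) • x i) =
            (‖φ (x i)‖ : ℂ) := by
          rw [map_smul, smul_eq_mul, mul_right_comm, mul_comm (starRingEnd ℂ _), Complex.mul_conj,
            Complex.normSq_eq_norm_sq]
          norm_cast
          field_simp
        rw [map_add, h1, Complex.add_re, Complex.ofReal_re]
        push_cast
        linarith
  have hlim : Tendsto (fun N : ℕ => (N : ℝ) ^ (1 - 1 / p)) atTop atTop :=
    (tendsto_rpow_atTop (sub_pos.2 ((div_lt_one hp0).2 hp))).comp tendsto_natCast_atTop_atTop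
  obtain ⟨N, hN1, hN0⟩ := ((hlim.eventually_gt_atTop (‖φ‖ * 2 ^ (1 / p) / ε)).and
    (eventually_gt_atTop 0)).exists
  have hN0' : (0 : ℝ) < N := by exact_mod_cast hN0
  obtain ⟨v, hv, hφ⟩ := hN N
  have h1 : ‖v‖ ≤ (2 * N : ℝ) ^ (1 / p) := by
    rw [one_div, Real.le_rpow_inv_iff_of_pos (norm_nonneg _) (by positivity) hp0]
    exact hv
  have h2 : N * ε ≤ ‖φ‖ * (2 ^ (1 / p) * (N : ℝ) ^ (1 / p)) := by
    rw [← Real.mul_rpow zero_le_two hN0'.le]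
    exact hφ.trans ((Complex.re_le_norm _).trans ((φ.le_opNorm v).trans (by gcongr)))
  rw [div_lt_iff₀ hε, Real.rpow_sub hN0', Real.rpow_one, div_mul_eq_mul_div,
    lt_div_iff₀ (by positivity)] at hN1
  linarith

namespace MeasureTheory

variable {Ω : Type*} [MeasurableSpace Ω] {μ : Measure Ω} {E : Type*} [NormedAddCommGroup E]

theorem eLpNorm_piecewise_le {f g : Ω → E} {S : Set Ω} [DecidablePred (· ∈ S)]
    (hS : MeasurableSet S) {p : ℝ} (hp : 0 < p) :
    eLpNorm (S.piecewise f g) (ENNReal.ofReal p) μ ≤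
      (eLpNorm f (ENNReal.ofReal p) μ ^ p + eLpNorm g (ENNReal.ofReal p) μ ^ p) ^ (1 / p) := by
  have e : ∀ u : Ω → E, eLpNorm u (ENNReal.ofReal p) μ = (∫⁻ a, ‖u a‖ₑ ^ p ∂μ) ^ (1 / p) :=
    fun u => by
      rw [eLpNorm_eq_lintegral_rpow_enorm_toReal (by simpa using hp) ENNReal.ofReal_ne_top,
        ENNReal.toReal_ofReal hp.le]
  simp only [e]
  refine ENNReal.rpow_le_rpow ?_ (by positivity)
  rw [← ENNReal.rpow_mul, ← ENNReal.rpow_mul, one_div_mul_cancel hp.ne', ENNReal.rpow_one,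
    ENNReal.rpow_one, ← lintegral_add_compl _ hS]
  refine add_le_add ?_ ?_
  · rw [setLIntegral_congr_fun (g := fun a => ‖f a‖ₑ ^ p) hS fun a ha => by simp [ha]]
    exact setLIntegral_le_lintegral _ _
  · rw [setLIntegral_congr_fun (g := fun a => ‖g a‖ₑ ^ p) hS.compl fun a ha => by
      simp [Set.piecewise_eq_of_notMem _ _ _ ha]]
    exact setLIntegral_le_lintegral _ _

theorem eventually_eLpNorm_add_le [NormedSpace ℂ E] {ι : Type*} {l : Filter ι} {p : ℝ} (hp : 1 ≤ p)
    {v : Ω → E} (hv : MemLp v (ENNReal.ofReal p) μ) {x : ι → Ω → E}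
    (hx : ∀ i, MemLp (x i) (ENNReal.ofReal p) μ)
    (hx1 : ∀ i, eLpNorm (x i) (ENNReal.ofReal p) μ ≤ 1)
    (hconc : ∀ δ : ℝ, 0 < δ → ∃ S, MeasurableSet S ∧ μ Sᶜ ≤ ENNReal.ofReal δ ∧
      Tendsto (fun i => eLpNorm (S.indicator (x i)) (ENNReal.ofReal p) μ) l (𝓝 0))
    {ε : ℝ} (hε : 0 < ε) :
    ∀ᶠ i in l, ∀ c : ℂ, ‖c‖ ≤ 1 → eLpNorm (v + c • x i) (ENNReal.ofReal p) μ ≤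
      (eLpNorm v (ENNReal.ofReal p) μ ^ p + 1) ^ (1 / p) + ENNReal.ofReal ε := by
  classical
  have hp0 : 0 < p := one_pos.trans_le hp
  have hp1 : 1 ≤ ENNReal.ofReal p := by simpa using hp
  obtain ⟨δ, hδ, hvδ⟩ := hv.eLpNorm_indicator_le hp1 ENNReal.ofReal_ne_top (half_pos hε)
  obtain ⟨S, hS, hSδ, hlim⟩ := hconc δ hδ
  have hpos : (0 : ℝ≥0∞) < ENNReal.ofReal (ε / 2) := by simpa using hε
  filter_upwards [hlim.eventually_le_const hpos] with i hi c hc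
  have hcx : ∀ u : Ω → E,
      eLpNorm (c • u) (ENNReal.ofReal p) μ ≤ eLpNorm u (ENNReal.ofReal p) μ := fun u => by
    rw [eLpNorm_const_smul]
    refine mul_le_of_le_one_left zero_le ?_
    rwa [← ofReal_norm, ENNReal.ofReal_le_one]
  have e : v + c • x i = S.piecewise v (c • x i) +
      (Sᶜ.indicator v + S.indicator (c • x i)) := by
    funext a
    by_cases ha : a ∈ S <;> simp [ha, add_comm]
  have hm := (hx i).const_smul c
  rw [e]
  refine (eLpNorm_add_le (hv.1.restrict.piecewise hS hm.1.restrict) ((hv.1.indicator hS.compl).add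
    (hm.1.indicator hS)) hp1).trans (add_le_add ?_ ?_)
  · refine (eLpNorm_piecewise_le hS hp0).trans ?_
    refine ENNReal.rpow_le_rpow (add_le_add le_rfl ?_) (by positivity)
    calc _ ≤ (1 : ℝ≥0∞) ^ p := ENNReal.rpow_le_rpow ((hcx _).trans (hx1 i)) hp0.le
      _ = 1 := ENNReal.one_rpow p
  · refine (eLpNorm_add_le (hv.1.indicator hS.compl) (hm.1.indicator hS) hp1).trans ?_
    rw [← add_halves ε, ENNReal.ofReal_add (by positivity) (by positivity)]
    refine add_le_add (hvδ _ hS.compl hSδ) ?_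
    rw [show S.indicator (c • x i) = c • S.indicator (x i) from Set.indicator_const_smul S c (x i)]
    exact (hcx _).trans hi

end MeasureTheory

namespace ModifiedBergman

theorem tendsto_norm_towardsBoundary :
    Tendsto (fun z : puncturedDisk => ‖(z : ℂ)‖) towardsBoundary (𝓝 1) :=
  tendsto_comap.mono_right nhdsWithin_le_nhds

instance : towardsBoundary.IsCountablyGenerated := by
  unfold towardsBoundary
  infer_instance

/-- The peaking functions `w ↦ (1 - |z|) / (1 - w z̄)`. -/
noncomputable def peakFunction (z w : ℂ) : ℂ :=
  ((1 - ‖z‖ : ℝ) : ℂ) / (1 - w * starRingEnd ℂ z)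

theorem norm_one_sub_mul_conj_ge (w z : ℂ) : 1 - ‖w‖ * ‖z‖ ≤ ‖1 - w * starRingEnd ℂ z‖ := by
  have := norm_sub_norm_le (1 : ℂ) (w * starRingEnd ℂ z)
  rwa [norm_one, norm_mul, RCLike.norm_conj] at this

theorem one_sub_norm_mul_pos {w z : ℂ} (hw : w ∈ puncturedDisk) (hz : z ∈ puncturedDisk) :
    0 < 1 - ‖w‖ * ‖z‖ :=
  sub_pos.2 (mul_lt_one_of_nonneg_of_lt_one_left (norm_nonneg _) hw.2 hz.2.le)

theorem norm_peakFunction_le {w z : ℂ} (hw : w ∈ puncturedDisk) (hz : z ∈ puncturedDisk) :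
    ‖peakFunction z w‖ ≤ (1 - ‖z‖) / (1 - ‖w‖ * ‖z‖) := by
  have h0 : 0 ≤ 1 - ‖z‖ := by linarith [hz.2]
  rw [peakFunction, norm_div, Complex.norm_real, Real.norm_of_nonneg h0]
  exact div_le_div_of_nonneg_left h0 (one_sub_norm_mul_pos hw hz) (norm_one_sub_mul_conj_ge w z)

theorem norm_peakFunction_le_one {w z : ℂ} (hw : w ∈ puncturedDisk) (hz : z ∈ puncturedDisk) :
    ‖peakFunction z w‖ ≤ 1 := by
  refine (norm_peakFunction_le hw hz).trans ((div_le_one (one_sub_norm_mul_pos hw hz)).2 ?_)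
  have := mul_le_of_le_one_left (norm_nonneg z) hw.2.le
  linarith

theorem norm_peakFunction_self {z : ℂ} (hz : z ∈ puncturedDisk) : 1 / 2 ≤ ‖peakFunction z z‖ := by
  have h1 := hz.2
  have h2 : (1 : ℂ) - z * starRingEnd ℂ z = ((1 - ‖z‖ ^ 2 : ℝ) : ℂ) := by
    rw [Complex.mul_conj, Complex.normSq_eq_norm_sq]
    push_cast
    rfl
  have h3 : 0 < 1 - ‖z‖ ^ 2 := by nlinarith [hz.1]
  rw [peakFunction, h2, ← Complex.ofReal_div, Complex.norm_real,
    Real.norm_of_nonneg (div_nonneg (by linarith) h3.le), div_le_div_iff₀ two_pos h3]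
  nlinarith

theorem differentiableOn_peakFunction {z : ℂ} (hz : z ∈ puncturedDisk) :
    DifferentiableOn ℂ (peakFunction z) puncturedDisk := by
  unfold peakFunction
  refine (differentiableOn_const _).div (by fun_prop) fun w hw h => ?_
  have := norm_one_sub_mul_conj_ge w z
  rw [h, norm_zero] at this
  linarith [one_sub_norm_mul_pos hw hz]

theorem memBergman_peakFunction {α β : ℝ} (hα : -1 < α) (hβ : -1 < β) (p : ℝ) {z : ℂ}
    (hz : z ∈ puncturedDisk) : MemBergman α β p (peakFunction z) := by
  have := isProbabilityMeasure_bergmanMeasure hα hβ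
  have hd := differentiableOn_peakFunction hz
  refine ⟨hd, MemLp.of_bound (aestronglyMeasurable_of_continuousOn hd.continuousOn α β) 1 ?_⟩
  filter_upwards [ae_mem_puncturedDisk α β] with w hw using norm_peakFunction_le_one hw hz

theorem tendsto_integral_norm_peakFunction {α β q : ℝ} (hα : -1 < α) (hβ : -1 < β) (hq : 0 < q) :
    Tendsto (fun z : puncturedDisk => ∫ w, ‖peakFunction z w‖ ^ q ∂bergmanMeasure α β)
      towardsBoundary (𝓝 0) := by
  have := isProbabilityMeasure_bergmanMeasure hα hβ
  rw [← integral_zero ℂ ℝ (μ := bergmanMeasure α β)]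
  refine tendsto_integral_filter_of_norm_le_const (Eventually.of_forall fun z => ?_)
    ⟨1, Eventually.of_forall fun z => ?_⟩ ?_
  · exact aestronglyMeasurable_of_continuousOn ((differentiableOn_peakFunction
      z.2).continuousOn.norm.rpow_const fun _ _ => Or.inr hq.le) α β
  · filter_upwards [ae_mem_puncturedDisk α β] with w hw
    rw [Real.norm_of_nonneg (by positivity)]
    exact Real.rpow_le_one (norm_nonneg _) (norm_peakFunction_le_one hw z.2) hq.le
  · filter_upwards [ae_mem_puncturedDisk α β] with w hw
    have h1 : Tendsto (fun z : puncturedDisk => (1 - ‖(z : ℂ)‖) / (1 - ‖w‖ * ‖(z : ℂ)‖))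
        towardsBoundary (𝓝 ((1 - 1) / (1 - ‖w‖ * 1))) :=
      (tendsto_const_nhds.sub tendsto_norm_towardsBoundary).div
        (tendsto_const_nhds.sub (tendsto_const_nhds.mul tendsto_norm_towardsBoundary))
        (by linarith [hw.2])
    rw [sub_self, zero_div] at h1
    have h2 : Tendsto (fun z : puncturedDisk => ‖peakFunction z w‖) towardsBoundary (𝓝 0) :=
      squeeze_zero (fun _ => norm_nonneg _) (fun z => norm_peakFunction_le hw z.2) h1
    simpa [Real.zero_rpow hq.ne'] using h2.rpow_const (Or.inr hq.le)

/-- The norms of the kernels blow up at the boundary. -/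
theorem tendsto_inv_bergmanNorm_bergmanKernel {α β p : ℝ} (hα : -1 < α) (hβ : -1 < β) (hp : 1 < p)
    (h : poleOrder β * p < 2 * (β + 1)) :
    Tendsto (fun z : puncturedDisk => (bergmanNorm α β p fun w => bergmanKernel α β w z)⁻¹)
      towardsBoundary (𝓝 0) := by
  have hpq := Real.HolderConjugate.conjExponent hp
  set q := p.conjExponent
  have hq : 0 < q := hpq.symm.pos
  have hle : ∀ z : puncturedDisk, (bergmanNorm α β p fun w => bergmanKernel α β w z)⁻¹ ≤
      2 * (∫ w, ‖peakFunction z w‖ ^ q ∂bergmanMeasure α β) ^ (1 / q) := by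
    intro z
    have h1 := (isReproducingKernel_bergmanKernel hα hβ z z.2).2 _
      (memBergman_peakFunction hα hβ 2 z.2)
    have h2 := integral_mul_norm_le_Lp_mul_Lq hpq.symm (memBergman_peakFunction hα hβ q z.2).2
      (memBergman_bergmanKernel hα hβ (one_pos.trans hp) h z.2).2
    have h3 := norm_integral_le_integral_norm (μ := bergmanMeasure α β)
      fun w => peakFunction z w * starRingEnd ℂ (bergmanKernel α β w z)
    simp only [norm_mul, RCLike.norm_conj] at h3
    rw [h1] at h3
    have h4 := (norm_peakFunction_self z.2).trans (h3.trans h2)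
    change 1 / 2 ≤ _ * bergmanNorm α β p (fun w => bergmanKernel α β w z) at h4
    have hN : 0 ≤ bergmanNorm α β p (fun w => bergmanKernel α β w z) := by
      unfold bergmanNorm
      positivity
    have hN' : 0 < bergmanNorm α β p (fun w => bergmanKernel α β w z) := by
      refine hN.lt_of_ne fun h0 => ?_
      rw [← h0, mul_zero] at h4
      linarith
    rw [inv_le_iff_one_le_mul₀ hN']
    linarith
  refine squeeze_zero (fun z => ?_) hle ?_
  · unfold bergmanNorm
    positivity
  · have := ((tendsto_integral_norm_peakFunction hα hβ hq).rpow_const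
      (p := 1 / q) (Or.inr (by positivity))).const_mul 2
    simpa [Real.zero_rpow (inv_pos.2 hq).ne'] using this

theorem normalizedKernel_eq (α β p : ℝ) (z : ℂ) : normalizedKernel α β p z =
    ((bergmanNorm α β p fun w => bergmanKernel α β w z : ℝ) : ℂ)⁻¹ •
      fun w => bergmanKernel α β w z := by
  funext w
  simp [normalizedKernel, div_eq_inv_mul]

theorem eLpNorm_eq_bergmanNorm {α β p : ℝ} (hp : 0 < p) {f : ℂ → ℂ} (hf : MemBergman α β p f) :
    eLpNorm f (ENNReal.ofReal p) (bergmanMeasure α β) = ENNReal.ofReal (bergmanNorm α β p f) := by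
  rw [hf.2.eLpNorm_eq_integral_rpow_norm (by simpa using hp) ENNReal.ofReal_ne_top,
    ENNReal.toReal_ofReal hp.le, bergmanNorm, one_div]

theorem eLpNorm_normalizedKernel_le {α β p : ℝ} (hp : 0 < p) {z : ℂ}
    (h : MemBergman α β p fun w => bergmanKernel α β w z) :
    eLpNorm (normalizedKernel α β p z) (ENNReal.ofReal p) (bergmanMeasure α β) ≤ 1 := by
  have hN : 0 ≤ bergmanNorm α β p (fun w => bergmanKernel α β w z) := by
    unfold bergmanNorm
    positivity
  rw [normalizedKernel_eq, eLpNorm_const_smul, eLpNorm_eq_bergmanNorm hp h, ← ofReal_norm,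
    ← ENNReal.ofReal_mul (norm_nonneg _), ENNReal.ofReal_le_one, norm_inv, Complex.norm_real,
    Real.norm_of_nonneg hN]
  exact inv_mul_le_one

/-- The mass of the normalized kernels escapes to the boundary. -/
theorem tendsto_eLpNorm_indicator_normalizedKernel {α β p : ℝ} (hα : -1 < α) (hβ : -1 < β)
    (hp : 1 < p) (h : poleOrder β * p < 2 * (β + 1)) {R : ℝ} (hR : R < 1) :
    Tendsto (fun z : puncturedDisk => eLpNorm
      ((Metric.closedBall 0 R).indicator (normalizedKernel α β p z)) (ENNReal.ofReal p)
      (bergmanMeasure α β)) towardsBoundary (𝓝 0) := by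
  obtain ⟨C, hC, hK⟩ := exists_norm_bergmanKernel_le hα hβ hR
  set m := poleOrder β
  have hmem := memLp_norm_pow_inv hα hβ (one_pos.trans hp) h
  have hlim : Tendsto (fun z : puncturedDisk => ENNReal.ofReal
      ((bergmanNorm α β p fun w => bergmanKernel α β w z)⁻¹ * (C * 2 ^ m)) *
      eLpNorm (fun w : ℂ => (‖w‖ ^ m)⁻¹) (ENNReal.ofReal p) (bergmanMeasure α β))
      towardsBoundary (𝓝 0) := by
    have h1 := ENNReal.tendsto_ofReal
      ((tendsto_inv_bergmanNorm_bergmanKernel hα hβ hp h).mul_const (C * 2 ^ m))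
    simpa using ENNReal.Tendsto.mul_const h1 (Or.inr hmem.2.ne)
  refine tendsto_of_tendsto_of_tendsto_of_le_of_le' tendsto_const_nhds hlim
    (Eventually.of_forall fun _ => zero_le) ?_
  filter_upwards [tendsto_norm_towardsBoundary.eventually_const_le
    (show (1 / 2 : ℝ) < 1 by norm_num)] with z hz
  refine eLpNorm_le_mul_eLpNorm_of_ae_le_mul ?_ _
  filter_upwards [ae_mem_puncturedDisk α β] with w hw
  have hN : 0 ≤ bergmanNorm α β p (fun w => bergmanKernel α β w z) := by
    unfold bergmanNorm
    positivity
  by_cases hwR : w ∈ Metric.closedBall (0 : ℂ) R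
  · have hwR' : ‖w‖ ≤ R := by simpa using hwR
    have hw0 := hw.1
    have h1 := hK w z ((mul_le_of_le_one_right (norm_nonneg _) z.2.2.le).trans hwR')
    have h2 : ((‖w‖ * ‖(z : ℂ)‖) ^ m)⁻¹ ≤ 2 ^ m * (‖w‖ ^ m)⁻¹ := by
      rw [mul_pow, mul_inv, mul_comm, ← inv_pow ‖(z : ℂ)‖]
      gcongr
      rw [inv_le_comm₀ z.2.1 two_pos]
      linarith
    rw [Set.indicator_of_mem hwR, normalizedKernel_eq, Pi.smul_apply, norm_smul, norm_inv,
      Complex.norm_real, Real.norm_of_nonneg hN, norm_inv, norm_pow, norm_norm, mul_assoc,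
      mul_assoc]
    gcongr
    exact h1.trans (by gcongr)
  · rw [Set.indicator_of_notMem hwR, norm_zero]
    positivity

theorem exists_measure_compl_closedBall_le {α β δ : ℝ} (hα : -1 < α) (hβ : -1 < β) (hδ : 0 < δ) :
    ∃ R < 1, bergmanMeasure α β (Metric.closedBall 0 R)ᶜ ≤ ENNReal.ofReal δ := by
  have := isProbabilityMeasure_bergmanMeasure hα hβ
  have hlim := tendsto_measure_iInter_atTop (μ := bergmanMeasure α β)
    (s := fun n : ℕ => (Metric.closedBall (0 : ℂ) (1 - 1 / ((n : ℝ) + 1)))ᶜ)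
    (fun n => Metric.isClosed_closedBall.measurableSet.compl.nullMeasurableSet)
    (fun n k hnk => Set.compl_subset_compl.2 (Metric.closedBall_subset_closedBall
      (sub_le_sub_left (Nat.one_div_le_one_div hnk) 1)))
    ⟨0, measure_ne_top _ _⟩
  have h0 : bergmanMeasure α β
      (⋂ n : ℕ, (Metric.closedBall (0 : ℂ) (1 - 1 / ((n : ℝ) + 1)))ᶜ) = 0 := by
    refine measure_mono_null (fun w hw => ?_) (ae_iff.1 (ae_mem_puncturedDisk α β))
    refine fun hwD : w ∈ puncturedDisk => ?_
    obtain ⟨n, hn⟩ := exists_nat_one_div_lt (sub_pos.2 hwD.2)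
    refine Set.mem_iInter.1 hw n ?_
    rw [mem_closedBall_zero_iff]
    linarith
  rw [h0] at hlim
  have hpos : (0 : ℝ≥0∞) < ENNReal.ofReal δ := by simpa using hδ
  obtain ⟨n, hn⟩ := (hlim.eventually_le_const hpos).exists
  exact ⟨_, sub_lt_self _ (by positivity), hn⟩

theorem tendsto_apply_normalizedKernel {α β p : ℝ} (hα : -1 < α) (hβ : -1 < β)
    (hp : 1 < p) (h : poleOrder β * p < 2 * (β + 1)) [Fact (1 ≤ ENNReal.ofReal p)]
    (hK : ∀ z : puncturedDisk, MemBergman α β p (fun w => bergmanKernel α β w z))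
    (φ : bergmanSpace α β p →L[ℂ] ℂ) :
    Tendsto (fun z => φ (memBergman_normalizedKernel (hK z)).toBergman) towardsBoundary (𝓝 0) := by
  have hp0 : 0 < p := one_pos.trans hp
  refine tendsto_apply_of_eventually_norm_add_le hp (fun v ε hε => ?_) φ
  have hv := Lp.memLp (v : Lp ℂ (ENNReal.ofReal p) (bergmanMeasure α β))
  filter_upwards [eventually_eLpNorm_add_le hp.le hv
    (fun z => (memBergman_normalizedKernel (hK z)).2)
    (fun z => eLpNorm_normalizedKernel_le hp0 (hK z)) (fun δ hδ => by
      obtain ⟨R, hR, hRδ⟩ := exists_measure_compl_closedBall_le hα hβ hδ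
      exact ⟨_, Metric.isClosed_closedBall.measurableSet, hRδ,
        tendsto_eLpNorm_indicator_normalizedKernel hα hβ hp h hR⟩) hε] with z hz c hc
  have h1 := hz c hc
  have hae : ((v + c • (memBergman_normalizedKernel (hK z)).toBergman : bergmanSpace α β p) :
      Lp ℂ (ENNReal.ofReal p) (bergmanMeasure α β)) =ᵐ[bergmanMeasure α β]
      v + c • normalizedKernel α β p z :=
    (Lp.coeFn_add _ _).trans (EventuallyEq.rfl.add ((Lp.coeFn_smul c _).trans
      ((memBergman_normalizedKernel (hK z)).2.coeFn_toLp.const_smul c)))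
  have h2 : eLpNorm (v : Lp ℂ (ENNReal.ofReal p) (bergmanMeasure α β)) (ENNReal.ofReal p)
      (bergmanMeasure α β) = ENNReal.ofReal ‖v‖ := by
    rw [Submodule.coe_norm, Lp.norm_def, ENNReal.ofReal_toReal (Lp.eLpNorm_ne_top _)]
  rw [Submodule.coe_norm, Lp.norm_def, eLpNorm_congr_ae hae]
  refine ENNReal.toReal_le_of_le_ofReal (by positivity) (h1.trans (le_of_eq ?_))
  rw [h2, ENNReal.ofReal_rpow_of_nonneg (norm_nonneg _) hp0.le, ← ENNReal.ofReal_one,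
    ← ENNReal.ofReal_add (by positivity) zero_le_one,
    ENNReal.ofReal_rpow_of_nonneg (by positivity) (by positivity),
    ← ENNReal.ofReal_add (by positivity) hε.le]

end ModifiedBergman

theorem mainTheorem11 (α β p : ℝ) (hα : -1 < α) (hβ : -1 < β)
    (hp_lower : 2 * (β + 1) / (2 * (β + 1) - ModifiedBergman.poleOrder β) < p)
    (hp_upper : ModifiedBergman.poleOrder β * p < 2 * (β + 1))
    [Fact (1 ≤ ENNReal.ofReal p)] :
    ModifiedBergman.IsReproducingKernel α β (ModifiedBergman.bergmanKernel α β) ∧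
    ∃ hK : ∀ z : ModifiedBergman.puncturedDisk,
        ModifiedBergman.MemBergman α β p (fun w => ModifiedBergman.bergmanKernel α β w z),
      Tendsto
        (fun z : ModifiedBergman.puncturedDisk =>
          toWeakSpace ℂ (ModifiedBergman.bergmanSpace α β p)
            (ModifiedBergman.memBergman_normalizedKernel (hK z)).toBergman)
        ModifiedBergman.towardsBoundary (𝓝 0) := by
  have hm := (ModifiedBergman.poleOrder_spec hβ).1
  have hm0 : (0 : ℝ) ≤ ModifiedBergman.poleOrder β := Nat.cast_nonneg _
  have hp : 1 < p := by
    refine lt_of_le_of_lt ?_ hp_lower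
    rw [one_le_div (by linarith)]
    linarith
  have hK : ∀ z : ModifiedBergman.puncturedDisk,
      ModifiedBergman.MemBergman α β p (fun w => ModifiedBergman.bergmanKernel α β w z) :=
    fun z => ModifiedBergman.memBergman_bergmanKernel hα hβ (one_pos.trans hp) hp_upper z.2
  refine ⟨ModifiedBergman.isReproducingKernel_bergmanKernel hα hβ, hK, ?_⟩
  have hind : IsInducing fun (x : WeakSpace ℂ (ModifiedBergman.bergmanSpace α β p))
      (φ : StrongDual ℂ (ModifiedBergman.bergmanSpace α β p)) =>
        (topDualPairing ℂ (ModifiedBergman.bergmanSpace α β p)).flip x φ := ⟨rfl⟩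
  rw [hind.tendsto_nhds_iff, tendsto_pi_nhds]
  intro φ
  have h := ModifiedBergman.tendsto_apply_normalizedKernel hα hβ hp hp_upper hK φ
  rw [← map_zero φ] at h
  exact h
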